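/- Let $M_0>1$, $M_1,M_2>0$ and $0<\alpha<\beta<1$ be fixed. For integers $t\ge 1$, $s\ge 0$, let $\Theta=\Theta(t,s)$ be the set of all $\theta=(\beta_T,\beta_S,\Sigma,\sigma)$ with $\beta_T\in\mathbb R^t$, $\beta_S\in\mathbb R^s$, $\|\beta_T\|_2^2+\|\beta_S\|_2^2\le M_2$, $\Sigma$ a real symmetric $(t+s)\times(t+s)$ matrix with $M_0^{-1}\le\lambda_{\min}(\Sigma)\le\lambda_{\max}(\Sigma)\le M_0$, and $0<\sigma\le M_1$. Under $\mathbb P_\theta$ one observes $n$ i.i.d. copies $(\mathbf Y,\mathbf X)$ of $(Y,X)$, where $X=(X_T,X_S)\sim N_{t+s}(0,\Sigma)$ and $Y\mid X\sim N(X_T^\top\beta_T+X_S^\top\beta_S,\sigma^2)$. Partition $\Sigma$ into blocks according to $(T,S)$ and put $\Sigma_{T\mid S}=\Sigma_{TT}-\Sigma_{TS}\Sigma_{SS}^{-1}\Sigma_{ST}$. Let $$\Theta_0=\{\theta\in\Theta:\beta_T=0\},\quad \Theta_{\rm dense}(h)=\{\theta\in\Theta:\|\Sigma_{T\mid S}\beta_T\|_2\ge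 h\},\quad \Theta_{\rm sparse}(h)=\{\theta\in\Theta:\|\Sigma_{T\mid S}\beta_T\|_\infty\ge h\},$$ and let $\Phi_\alpha(\Theta_0)$ be the set of measurable functions $\psi$ of $(\mathbf Y,\mathbf X)$ with values in $[0,1]$ such that $\sup_{\theta\in\Theta_0}\mathbb E_\theta\psi\le\alpha$. **Theorem (label lower bound).** (1) For every $C_1>0$ there is a constant $c_3>0$, depending only on $\alpha,\beta,M_0,M_1,M_2,C_1$, such that for all sequences $t=t_n$ and $s=s_n$ of integers with $t_n\ge1$, $s_n\ge 0$ and $t_n\le C_1n^2$ for all sufficiently large $n$, $$\limsup_{n\to\infty}\ \sup_{\psi\in\Phi_\alpha(\Theta_0)}\ \inf_{\theta\in\Theta_{\rm dense}(h_{3,n})}\mathbb E_\theta\psi\ \le\ \beta,\qquad h_{3,n}=c_3\,\frac{t_n^{1/4}}{\sqrt n}.$$ (2) For every $C_2>0$ there is a constant $c_4>0$, depending only on $\alpha,\beta,M_0,M_1,M_2,C_2$, such that for all sequences $t=t_n$ and $s=s_n$ of integers with $t_n\ge1$, $s_n\ge 0$ and $\log t_n\le C_2n$ for all sufficiently large $n$,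 $$\limsup_{n\to\infty}\ \sup_{\psi\in\Phi_\alpha(\Theta_0)}\ \inf_{\theta\in\Theta_{\rm sparse}(h_{4,n})}\mathbb E_\theta\psi\ \le\ \beta,\qquad h_{4,n}=c_4\sqrt{\frac{\log t_n}{n}}.$$ Here the infimum over an empty set is $+\infty$. -/

import Mathlib

open MeasureTheory ProbabilityTheory Filter Topology
open scoped Matrix

noncomputable section

namespace CondTest

/-- The covariate space `ℝ^p`, `p = t + s`: the coordinates `Sum.inl` are those in `𝒯` (the
tested covariates), the coordinates `Sum.inr` are those in `𝒮`. -/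
abbrev Covariate (t s : ℕ) : Type := EuclideanSpace ℝ (Fin t ⊕ Fin s)

/-- The parameters `θ = (β_𝒯, β_𝒮, Σ, σ)`. -/
structure Param (t s : ℕ) where
  betaT : EuclideanSpace ℝ (Fin t)
  betaS : EuclideanSpace ℝ (Fin s)
  Sig : Matrix (Fin t ⊕ Fin s) (Fin t ⊕ Fin s) ℝ
  sigma : ℝ

namespace Param

variable {t s : ℕ}

/-- The regression function `x ↦ x_𝒯ᵀ β_𝒯 + x_𝒮ᵀ β_𝒮`. -/
def regression (θ : Param t s) (x : Covariate t s) : ℝ :=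
  (∑ i, x (Sum.inl i) * θ.betaT i) + ∑ j, x (Sum.inr j) * θ.betaS j

theorem measurable_regression (θ : Param t s) : Measurable θ.regression := by
  unfold regression
  fun_prop

/-- The conditional distribution `Y ∣ X = x ∼ N(x_𝒯ᵀ β_𝒯 + x_𝒮ᵀ β_𝒮, σ²)`. -/
def responseKernel (θ : Param t s) : Kernel (Covariate t s) ℝ where
  toFun x := gaussianReal (θ.regression x) (Real.toNNReal (θ.sigma ^ 2))
  measurable' := measurable_gaussianReal.comp (θ.measurable_regression.prodMk measurable_const)

instance (θ : Param t s) : IsMarkovKernel θ.responseKernel :=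
  ⟨fun x => by
    change IsProbabilityMeasure (gaussianReal (θ.regression x) (Real.toNNReal (θ.sigma ^ 2)))
    infer_instance⟩

/-- The joint law of one observation `(X, Y)`: `X ∼ N_p(0, Σ)`, and `Y` given `X` follows the
linear model. -/
def obsLaw (θ : Param t s) : Measure (Covariate t s × ℝ) :=
  (multivariateGaussian 0 θ.Sig) ⊗ₘ θ.responseKernel

instance (θ : Param t s) : IsProbabilityMeasure θ.obsLaw := by
  unfold obsLaw
  infer_instance

/-- The law `ℙ_θ` of the data: `n` i.i.d. observations `(X_i, Y_i)`. -/
def sampleLaw (θ : Param t s) (n : ℕ) : Measure (Fin n → Covariate t s × ℝ) :=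
  Measure.pi fun _ => θ.obsLaw

/-- `Σ_{𝒯∣𝒮} = Σ_{𝒯𝒯} - Σ_{𝒯𝒮} Σ_{𝒮𝒮}⁻¹ Σ_{𝒮𝒯}`. -/
def condCov (θ : Param t s) : Matrix (Fin t) (Fin t) ℝ :=
  θ.Sig.toBlocks₁₁ - θ.Sig.toBlocks₁₂ * θ.Sig.toBlocks₂₂⁻¹ * θ.Sig.toBlocks₂₁

/-- The vector `Σ_{𝒯∣𝒮} β_𝒯`. As an element of `Fin t → ℝ` its norm is the `ℓ_∞` norm. -/
def signal (θ : Param t s) : Fin t → ℝ :=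
  θ.condCov *ᵥ (θ.betaT : Fin t → ℝ)

end Param

/-- The parameter space `Θ`. -/
def paramSpace (M₀ M₁ M₂ : ℝ) (t s : ℕ) : Set (Param t s) :=
  {θ | (∃ h : θ.Sig.IsHermitian, ∀ i, M₀⁻¹ ≤ h.eigenvalues i ∧ h.eigenvalues i ≤ M₀) ∧
    0 < θ.sigma ∧ θ.sigma ≤ M₁ ∧ ‖θ.betaT‖ ^ 2 + ‖θ.betaS‖ ^ 2 ≤ M₂}

/-- The null space `Θ₀ = {θ ∈ Θ : β_𝒯 = 0}`. -/
def nullSpace (M₀ M₁ M₂ : ℝ) (t s : ℕ) : Set (Param t s) :=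
  {θ | θ ∈ paramSpace M₀ M₁ M₂ t s ∧ θ.betaT = 0}

/-- The dense alternatives, separated in `ℓ₂` norm. -/
def denseAlt (M₀ M₁ M₂ : ℝ) (t s : ℕ) (h : ℝ) : Set (Param t s) :=
  {θ | θ ∈ paramSpace M₀ M₁ M₂ t s ∧ h ≤ ‖WithLp.toLp 2 θ.signal‖}

/-- The sparse alternatives, separated in `ℓ_∞` norm. -/
def sparseAlt (M₀ M₁ M₂ : ℝ) (t s : ℕ) (h : ℝ) : Set (Param t s) :=
  {θ | θ ∈ paramSpace M₀ M₁ M₂ t s ∧ h ≤ ‖θ.signal‖}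

/-- The (randomized) tests based on `n` observations, of level `α` with respect to a null set. -/
def levelTests {t s : ℕ} (n : ℕ) (α : ℝ) (null : Set (Param t s)) :
    Set ((Fin n → Covariate t s × ℝ) → ℝ) :=
  {ψ | Measurable ψ ∧ (∀ z, 0 ≤ ψ z ∧ ψ z ≤ 1) ∧ ∀ θ ∈ null, ∫ z, ψ z ∂(θ.sampleLaw n) ≤ α}

/-- The largest worst-case power `sup_ψ inf_θ 𝔼_θ ψ` over `alt` of a level-`α` test of `null`.
The values are extended reals, so that an infimum over an empty set of alternatives is `+∞`. -/
def maximinPower {t s : ℕ} (n : ℕ) (α : ℝ) (null alt : Set (Param t s)) : EReal :=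
  ⨆ ψ ∈ levelTests n α null, ⨅ θ ∈ alt, ((∫ z, ψ z ∂(θ.sampleLaw n) : ℝ) : EReal)

end CondTest

end

/-! The worst case already occurs for identity covariance and `β_S = 0`. Then `Σ_{T∣S} = 1`, the
signal is the vector `b = β_T` itself, and the covariates in `S` play no role. The null point is `b
= 0` with noise variance `M₁²`; an alternative with `‖b‖ = r` gets noise variance `M₁² - r²`, so
that the marginal laws of `X` and of `Y` are the same in both and only their dependence carries
information.

With this matching the likelihood ratios satisfy `E₀[L_b L_b'] = (1 - ⟨b, b'⟩ / M₁²)⁻¹` per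
observation, hence its `n`-th power for the sample (`lintegral_gaussianRatio_mul_stdGaussian`,
`lintegral_obsRatio_mul`). By the second moment method (`exists_integral_withDensity_le`), it
suffices to find a finite family of vectors `b` for which the average of this kernel over pairs is
at most `1 + (β - α)²`.

Dense case: all vectors with entries `± r / √t`. The term of the kernel linear in `⟨b, b'⟩` averages
to zero by symmetry, and the quadratic remainder is controlled by sub-Gaussian moments of a
Rademacher sum, which allows `r² ≍ √t / n`. Sparse case: the vectors `r eᵢ`. Distinct vectors are
orthogonal, so only the diagonal contributes, and it is harmless while `exp(2 n r² / M₁²)` is a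
small power of `t`, that is, `r² ≍ log t / n`. The growth conditions on `t` keep `r` bounded, as the
parameter space requires. -/

namespace CondTest

/-! ### One-dimensional Gaussian integrals and likelihood ratios -/

open Real in
theorem lintegral_exp_quadratic {A : ℝ} (hA : 0 < A) (B : ℝ) :
    ∫⁻ y, ENNReal.ofReal (exp (-A * y ^ 2 + B * y)) =
      ENNReal.ofReal (√(π / A) * exp (B ^ 2 / (4 * A))) := by
  have h1 : ∀ y : ℝ, ENNReal.ofReal (exp (-A * y ^ 2 + B * y)) =
      ENNReal.ofReal (exp (B ^ 2 / (4 * A))) *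
        ENNReal.ofReal (exp (-A * (y - B / (2 * A)) ^ 2)) := by
    intro y
    rw [← ENNReal.ofReal_mul (exp_nonneg _), ← exp_add]
    congr 2
    field_simp
    ring
  simp_rw [h1]
  rw [lintegral_const_mul _ (by fun_prop),
    lintegral_sub_right_eq_self (fun y => ENNReal.ofReal (exp (-A * y ^ 2))),
    ← ofReal_integral_eq_lintegral_ofReal (integrable_exp_neg_mul_sq hA)
      (ae_of_all _ fun _ => exp_nonneg _), integral_gaussian,
    ← ENNReal.ofReal_mul (exp_nonneg _), mul_comm]

open Real in
theorem lintegral_exp_mul_sq_gaussianReal (v : NNReal) {c : ℝ} (hc : 0 < 1 - 2 * c * v) :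
    ∫⁻ x, ENNReal.ofReal (exp (c * x ^ 2)) ∂(gaussianReal 0 v) =
      ENNReal.ofReal (√(1 - 2 * c * v))⁻¹ := by
  -- The degenerate variance is needed later: `b = b'` gives `‖b - b'‖ = 0`.
  rcases eq_or_ne v 0 with rfl | hv
  · simp
  have hv' : (0 : ℝ) < v := by positivity
  rw [gaussianReal_of_var_ne_zero _ hv,
    lintegral_withDensity_eq_lintegral_mul _ (measurable_gaussianPDF _ _) (by fun_prop)]
  have hA : 0 < (1 - 2 * c * v) / (2 * v) := by positivity
  have h1 : ∀ x : ℝ, (gaussianPDF 0 v * fun x => ENNReal.ofReal (exp (c * x ^ 2))) x =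
      ENNReal.ofReal (√(2 * π * v))⁻¹ *
        ENNReal.ofReal (exp (-((1 - 2 * c * v) / (2 * v)) * x ^ 2 + 0 * x)) := by
    intro x
    simp only [Pi.mul_apply, gaussianPDF, gaussianPDFReal]
    rw [← ENNReal.ofReal_mul (by positivity), ← ENNReal.ofReal_mul (by positivity), mul_assoc,
      ← exp_add]
    congr 3
    field_simp
    ring
  simp_rw [h1]
  rw [lintegral_const_mul _ (by fun_prop), lintegral_exp_quadratic hA,
    ← ENNReal.ofReal_mul (by positivity)]
  congr 1
  simp only [ne_eq, OfNat.ofNat_ne_zero, not_false_eq_true, zero_pow, zero_div, exp_zero, mul_one]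
  rw [← Real.sqrt_inv, ← Real.sqrt_inv, ← Real.sqrt_mul (by positivity)]
  congr 1
  field_simp

/-- The density of `N(m, v)` with respect to `N(0, v₀)`. -/
noncomputable def gaussianRatio (v v₀ m y : ℝ) : ℝ :=
  √(v₀ / v) * Real.exp (-(y - m) ^ 2 / (2 * v) + y ^ 2 / (2 * v₀))

theorem gaussianRatio_nonneg (v v₀ m y : ℝ) : 0 ≤ gaussianRatio v v₀ m y := by
  unfold gaussianRatio; positivity

theorem gaussianReal_eq_withDensity {v v₀ : NNReal} (hv : v ≠ 0) (hv₀ : v₀ ≠ 0) (m : ℝ) :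
    gaussianReal m v = (gaussianReal 0 v₀).withDensity
      fun y => ENNReal.ofReal (gaussianRatio v v₀ m y) := by
  have hm : Measurable fun y => ENNReal.ofReal (gaussianRatio v v₀ m y) := by
    unfold gaussianRatio; fun_prop
  rw [gaussianReal_of_var_ne_zero _ hv, gaussianReal_of_var_ne_zero _ hv₀,
    ← withDensity_mul _ (measurable_gaussianPDF _ _) hm]
  congr 1
  ext y
  have hv' : (0 : ℝ) < v := by positivity
  have hv₀' : (0 : ℝ) < v₀ := by positivity
  simp only [Pi.mul_apply, gaussianPDF, gaussianPDFReal, gaussianRatio]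
  rw [← ENNReal.ofReal_mul (by positivity)]
  congr 1
  rw [mul_mul_mul_comm, ← Real.exp_add]
  congr 1
  · rw [← Real.sqrt_inv, ← Real.sqrt_inv, ← Real.sqrt_mul (by positivity)]
    congr 1
    field_simp
  · congr 1
    field_simp
    ring

-- Since `v ≤ v₀`, the coefficient `2 v₀ - v` is positive and the quadratic in `y` is integrable.
-- Completing the square separates `m - m'` from `m + m'`; this is what makes the later average over
-- the design factor.
open Real in
theorem lintegral_gaussianRatio_mul {v v₀ : NNReal} (hv : 0 < v) (hv₀ : v ≤ v₀) (m m' : ℝ) :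
    ∫⁻ y, ENNReal.ofReal (gaussianRatio v v₀ m y) * ENNReal.ofReal (gaussianRatio v v₀ m' y)
        ∂(gaussianReal 0 v₀) =
      ENNReal.ofReal (v₀ / √(v * (2 * v₀ - v))) *
        (ENNReal.ofReal (exp (-(1 / (4 * v)) * (m - m') ^ 2)) *
          ENNReal.ofReal (exp (1 / (4 * (2 * v₀ - v)) * (m + m') ^ 2))) := by
  have h0 : 0 < v₀ := hv.trans_le hv₀
  have hv' : (0 : ℝ) < v := by exact_mod_cast hv
  have hv₀' : (0 : ℝ) < v₀ := by exact_mod_cast h0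
  have hle : (v : ℝ) ≤ v₀ := by exact_mod_cast hv₀
  have hd : (0 : ℝ) < 2 * v₀ - v := by linarith
  have hA : 0 < (2 * v₀ - v : ℝ) / (2 * v * v₀) := by positivity
  rw [gaussianReal_of_var_ne_zero _ h0.ne',
    lintegral_withDensity_eq_lintegral_mul _ (measurable_gaussianPDF _ _)
      (by unfold gaussianRatio; fun_prop)]
  have h1 : ∀ y : ℝ, (gaussianPDF 0 v₀ * fun y => ENNReal.ofReal (gaussianRatio v v₀ m y) *
        ENNReal.ofReal (gaussianRatio v v₀ m' y)) y =
      ENNReal.ofReal ((√(2 * π * v₀))⁻¹ * (v₀ / v) * exp (-(m ^ 2 + m' ^ 2) / (2 * v))) *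
        ENNReal.ofReal (exp (-((2 * v₀ - v : ℝ) / (2 * v * v₀)) * y ^ 2 +
          ((m + m') / v) * y)) := by
    intro y
    simp only [Pi.mul_apply, gaussianPDF, gaussianPDFReal, gaussianRatio]
    rw [← ENNReal.ofReal_mul (by positivity), ← ENNReal.ofReal_mul (by positivity),
      ← ENNReal.ofReal_mul (by positivity)]
    congr 1
    have hs : √((v₀ : ℝ) / v) * √((v₀ : ℝ) / v) = v₀ / v := Real.mul_self_sqrt (by positivity)
    have he : exp (-(y - 0) ^ 2 / (2 * v₀)) * (exp (-(y - m) ^ 2 / (2 * v) + y ^ 2 / (2 * v₀)) *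
        exp (-(y - m') ^ 2 / (2 * v) + y ^ 2 / (2 * v₀))) =
        exp (-(m ^ 2 + m' ^ 2) / (2 * v)) *
          exp (-((2 * v₀ - v : ℝ) / (2 * v * v₀)) * y ^ 2 + ((m + m') / v) * y) := by
      simp only [← exp_add]
      congr 1
      field_simp
      ring
    generalize √((v₀ : ℝ) / v) = q at hs ⊢
    rw [mul_assoc _ (exp _) (exp _), ← he, ← hs]
    ring
  simp_rw [h1]
  rw [lintegral_const_mul _ (by fun_prop), lintegral_exp_quadratic hA,
    ← ENNReal.ofReal_mul (by positivity), ← ENNReal.ofReal_mul (by positivity),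
    ← ENNReal.ofReal_mul (by positivity)]
  congr 1
  rw [mul_mul_mul_comm, ← exp_add, ← exp_add]
  congr 1
  · have e1 : √(π / ((2 * v₀ - v : ℝ) / (2 * v * v₀))) = √(2 * π * v₀) * √(v / (2 * v₀ - v)) := by
      rw [← Real.sqrt_mul (by positivity)]
      congr 1
      field_simp
    have e2 : √((v : ℝ) / (2 * v₀ - v)) = v / √(v * (2 * v₀ - v)) := by
      rw [Real.sqrt_div' _ hd.le, Real.sqrt_mul hv'.le, div_eq_div_iff (by positivity)
        (by positivity), ← mul_assoc, Real.mul_self_sqrt hv'.le]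
    rw [e1, e2]
    field_simp
  · congr 1
    field_simp
    ring

/-! ### Averaging the product of two likelihood ratios over a Gaussian design -/

section StdGaussian

variable {E : Type*} [NormedAddCommGroup E] [InnerProductSpace ℝ E] [FiniteDimensional ℝ E]
  [MeasurableSpace E] [BorelSpace E]

theorem map_inner_stdGaussian (a : E) :
    (stdGaussian E).map (fun x => inner ℝ a x) = gaussianReal 0 (‖a‖ ^ 2).toNNReal := by
  have h := IsGaussian.map_eq_gaussianReal (μ := stdGaussian E) (innerSL ℝ a)
  rw [integral_strongDual_stdGaussian, variance_dual_stdGaussian, innerSL_apply_norm] at h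
  exact h

theorem indepFun_inner_stdGaussian {a b : E} (hab : inner ℝ a b = 0) :
    IndepFun (fun x : E => inner ℝ a x) (fun x : E => inner ℝ b x) (stdGaussian E) := by
  have hg : HasGaussianLaw (fun x : E => ((innerSL ℝ a) x, (innerSL ℝ b) x)) (stdGaussian E) :=
    ⟨inferInstanceAs (IsGaussian ((stdGaussian E).map ((innerSL ℝ a).prod (innerSL ℝ b))))⟩
  refine hg.indepFun_of_covariance_eq_zero ?_
  have h := covarianceBilin_apply_eq_cov (μ := stdGaussian E) IsGaussian.memLp_two_id a b
  rw [covarianceBilin_stdGaussian, innerSL_apply_apply, hab] at h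
  exact h.symm

theorem lintegral_gaussianRatio_mul_stdGaussian {v v₀ : NNReal} (hv : 0 < v) {b b' : E}
    (hb : ‖b‖ ^ 2 = v₀ - v) (hb' : ‖b'‖ ^ 2 = v₀ - v) :
    ∫⁻ x, ∫⁻ y, ENNReal.ofReal (gaussianRatio v v₀ (inner ℝ b x) y) *
        ENNReal.ofReal (gaussianRatio v v₀ (inner ℝ b' x) y) ∂(gaussianReal 0 v₀)
        ∂(stdGaussian E) =
      ENNReal.ofReal (v₀ / (v₀ - inner ℝ b b')) := by
  have hle' : (v : ℝ) ≤ v₀ := by nlinarith [sq_nonneg ‖b‖]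
  have hle : v ≤ v₀ := by exact_mod_cast hle'
  have hv' : (0 : ℝ) < v := by exact_mod_cast hv
  have hnorm : ‖b'‖ = ‖b‖ := by
    rw [← sq_eq_sq₀ (norm_nonneg _) (norm_nonneg _), hb, hb']
  have hκ : inner ℝ b b' ≤ v₀ - v := by
    rw [← hb, sq]
    nth_rewrite 2 [← hnorm]
    exact real_inner_le_norm b b'
  have hκ' : -(v₀ - v) ≤ inner ℝ b b' := by
    rw [← hb, sq]
    nth_rewrite 2 [← hnorm]
    exact neg_le_of_abs_le (abs_real_inner_le_norm b b')
  simp_rw [lintegral_gaussianRatio_mul hv hle]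
  rw [lintegral_const_mul _ (by fun_prop)]
  have hs : ∀ x : E, (inner ℝ b x : ℝ) - inner ℝ b' x = inner ℝ (b - b') x := fun x =>
    (inner_sub_left _ _ _).symm
  have ha : ∀ x : E, (inner ℝ b x : ℝ) + inner ℝ b' x = inner ℝ (b + b') x := fun x =>
    (inner_add_left _ _ _).symm
  simp_rw [hs, ha]
  -- Equal norms make `b - b'` and `b + b'` orthogonal, so the two linear forms are independent
  -- Gaussians and the integral factors.
  have horth : inner ℝ (b - b') (b + b') = (0 : ℝ) := by
    rw [inner_sub_left, inner_add_right, inner_add_right, real_inner_self_eq_norm_sq,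
      real_inner_self_eq_norm_sq, hnorm, real_inner_comm]
    ring
  have hind := indepFun_inner_stdGaussian horth
  have hind2 := hind.comp (φ := fun w => ENNReal.ofReal (Real.exp (-(1 / (4 * (v : ℝ))) * w ^ 2)))
    (ψ := fun w => ENNReal.ofReal (Real.exp (1 / (4 * (2 * v₀ - v : ℝ)) * w ^ 2)))
    (by fun_prop) (by fun_prop)
  have hmul := lintegral_mul_eq_lintegral_mul_lintegral_of_indepFun'' (by fun_prop) (by fun_prop)
    hind2
  simp only [Function.comp_apply] at hmul
  rw [hmul]
  have m1 := lintegral_map (μ := stdGaussian E) (g := fun x : E => inner ℝ (b - b') x)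
    (f := fun w => ENNReal.ofReal (Real.exp (-(1 / (4 * (v : ℝ))) * w ^ 2))) (by fun_prop)
    (by fun_prop)
  have m2 := lintegral_map (μ := stdGaussian E) (g := fun x : E => inner ℝ (b + b') x)
    (f := fun w => ENNReal.ofReal (Real.exp (1 / (4 * (2 * v₀ - v : ℝ)) * w ^ 2))) (by fun_prop)
    (by fun_prop)
  have hd : (0 : ℝ) < 2 * v₀ - v := by linarith
  have hk : (0 : ℝ) < v₀ - inner ℝ b b' := by linarith
  have n1 : ‖b - b'‖ ^ 2 = 2 * (v₀ - v - inner ℝ b b') := by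
    rw [norm_sub_sq_real, hb, hb']; ring
  have n2 : ‖b + b'‖ ^ 2 = 2 * (v₀ - v + inner ℝ b b') := by
    rw [norm_add_sq_real, hb, hb']; ring
  -- Both moments produce the same numerator `v₀ - ⟨b, b'⟩`. The two inverse square roots therefore
  -- combine to a rational expression, and the denominators `v` and `2 v₀ - v` cancel the prefactor
  -- `1 / √(v (2 v₀ - v))`.
  have q1 : 1 - 2 * -(1 / (4 * (v : ℝ))) * (‖b - b'‖ ^ 2).toNNReal =
      (v₀ - inner ℝ b b') / v := by
    rw [Real.coe_toNNReal _ (sq_nonneg _), n1]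
    field_simp
    ring
  have q2 : 1 - 2 * (1 / (4 * (2 * v₀ - v : ℝ))) * (‖b + b'‖ ^ 2).toNNReal =
      (v₀ - inner ℝ b b') / (2 * v₀ - v) := by
    rw [Real.coe_toNNReal _ (sq_nonneg _), n2]
    field_simp
    ring
  rw [← m1, ← m2, map_inner_stdGaussian, map_inner_stdGaussian,
    lintegral_exp_mul_sq_gaussianReal _ (by rw [q1]; positivity),
    lintegral_exp_mul_sq_gaussianReal _ (by rw [q2]; positivity), q1, q2,
    ← ENNReal.ofReal_mul (by positivity), ← ENNReal.ofReal_mul (by positivity)]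
  congr 1
  rw [Real.sqrt_div hk.le, Real.sqrt_div hk.le, Real.sqrt_mul hv'.le, inv_div, inv_div]
  have hh := Real.mul_self_sqrt hk.le
  have h1 : (0 : ℝ) < √v := Real.sqrt_pos.2 hv'
  have h2 : 0 < √(2 * v₀ - v : ℝ) := Real.sqrt_pos.2 hd
  have h3 : 0 < √(v₀ - inner ℝ b b') := Real.sqrt_pos.2 hk
  nth_rewrite 3 [← hh]
  generalize √(2 * v₀ - v : ℝ) = q at h2 ⊢
  field_simp

end StdGaussian

/-! ### Product measures with densities and the second moment method -/

section Product

variable {Ω : Type*} [MeasurableSpace Ω]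

theorem lintegral_pi_prod {ι : Type*} [Fintype ι] (μ : Measure Ω) [IsProbabilityMeasure μ]
    {f : ι → Ω → ENNReal} (hf : ∀ i, Measurable (f i)) :
    ∫⁻ z, ∏ i, f i (z i) ∂(Measure.pi fun _ : ι => μ) = ∏ i, ∫⁻ x, f i x ∂μ := by
  rw [lintegral_prod_eq_prod_lintegral_of_indepFun Finset.univ
    (fun i (z : ι → Ω) => f i (z i)) (iIndepFun_pi fun i => (hf i).aemeasurable)
    fun i => (hf i).comp (measurable_pi_apply i)]
  refine Finset.prod_congr rfl fun i _ => ?_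
  exact (measurePreserving_eval (fun _ : ι => μ) i).lintegral_comp (hf i)

theorem pi_withDensity {ι : Type*} [Fintype ι] (μ : Measure Ω) [IsProbabilityMeasure μ]
    {f : Ω → ENNReal} (hf : Measurable f) [SigmaFinite (μ.withDensity f)] :
    (Measure.pi fun _ : ι => μ.withDensity f) =
      (Measure.pi fun _ : ι => μ).withDensity fun z => ∏ i, f (z i) := by
  refine Measure.pi_eq (μ := fun _ : ι => μ.withDensity f) fun s hs => ?_
  rw [withDensity_apply _ (MeasurableSet.univ_pi hs),
    ← lintegral_indicator (MeasurableSet.univ_pi hs)]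
  have h : ∀ z : ι → Ω, (Set.univ.pi s).indicator (fun z => ∏ i, f (z i)) z =
      ∏ i, (s i).indicator f (z i) := by
    intro z
    by_cases hz : z ∈ Set.univ.pi s
    · rw [Set.indicator_of_mem hz]
      exact Finset.prod_congr rfl fun i _ => (Set.indicator_of_mem (hz i trivial) f).symm
    · rw [Set.indicator_of_notMem hz]
      simp only [Set.mem_univ_pi, not_forall] at hz
      obtain ⟨i, hi⟩ := hz
      exact (Finset.prod_eq_zero (Finset.mem_univ i) (Set.indicator_of_notMem hi f)).symm
  simp_rw [h]
  rw [lintegral_pi_prod μ fun i => hf.indicator (hs i)]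
  refine Finset.prod_congr rfl fun i _ => ?_
  rw [lintegral_indicator (hs i), withDensity_apply _ (hs i)]

end Product

/-- The second moment method: if a mixture of the laws `μ.withDensity (g i)` has `χ²`-divergence at
most `δ²` from `μ`, then no test gains more than `δ` in power, uniformly over the mixture. -/
theorem exists_integral_withDensity_le {Ω ι : Type*} [MeasurableSpace Ω] [Fintype ι] [Nonempty ι]
    (μ : Measure Ω) [IsProbabilityMeasure μ] {g : ι → Ω → ℝ} (hg : ∀ i, Measurable (g i))
    (hg0 : ∀ i z, 0 ≤ g i z) (hg1 : ∀ i, ∫⁻ z, ENNReal.ofReal (g i z) ∂μ = 1)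
    {K : ι → ι → ℝ} (hK0 : ∀ i j, 0 ≤ K i j)
    (hK : ∀ i j, ∫⁻ z, ENNReal.ofReal (g i z) * ENNReal.ofReal (g j z) ∂μ = ENNReal.ofReal (K i j))
    {δ : ℝ} (hδ : 0 < δ)
    (hsum : ∑ i, ∑ j, K i j ≤ (Fintype.card ι : ℝ) ^ 2 * (1 + δ ^ 2))
    {ψ : Ω → ℝ} (hψ : Measurable ψ) (hψ01 : ∀ z, 0 ≤ ψ z ∧ ψ z ≤ 1) :
    ∃ i, ∫ z, ψ z ∂(μ.withDensity fun z => ENNReal.ofReal (g i z)) ≤ ∫ z, ψ z ∂μ + δ := by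
  have hgi : ∀ i, Integrable (g i) μ := fun i =>
    ⟨(hg i).aestronglyMeasurable, by
      rw [hasFiniteIntegral_iff_ofReal (ae_of_all _ (hg0 i)), hg1]; simp⟩
  have hgI : ∀ i, ∫ z, g i z ∂μ = 1 := fun i => by
    rw [integral_eq_lintegral_of_nonneg_ae (ae_of_all _ (hg0 i)) (hg i).aestronglyMeasurable, hg1]
    simp
  have hKl : ∀ i j, ∫⁻ z, ENNReal.ofReal (g i z * g j z) ∂μ = ENNReal.ofReal (K i j) := by
    intro i j
    rw [← hK]
    exact lintegral_congr fun z => ENNReal.ofReal_mul (hg0 i z)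
  have hKi : ∀ i j, Integrable (fun z => g i z * g j z) μ := fun i j =>
    ⟨((hg i).mul (hg j)).aestronglyMeasurable, by
      rw [hasFiniteIntegral_iff_ofReal (ae_of_all _ fun z => mul_nonneg (hg0 i z) (hg0 j z)), hKl]
      simp⟩
  have hKI : ∀ i j, ∫ z, g i z * g j z ∂μ = K i j := fun i j => by
    rw [integral_eq_lintegral_of_nonneg_ae (ae_of_all _ fun z => mul_nonneg (hg0 i z) (hg0 j z))
      ((hg i).mul (hg j)).aestronglyMeasurable, hKl, ENNReal.toReal_ofReal (hK0 i j)]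
  have hψb : ∀ᵐ z ∂μ, ‖ψ z‖ ≤ 1 := ae_of_all _ fun z => by
    rw [Real.norm_of_nonneg (hψ01 z).1]; exact (hψ01 z).2
  have hψi : Integrable ψ μ := Integrable.of_bound hψ.aestronglyMeasurable 1 hψb
  have hgψ : ∀ i, Integrable (fun z => g i z * ψ z) μ := fun i =>
    (hgi i).mul_bdd hψ.aestronglyMeasurable hψb
  have hpow : ∀ i, ∫ z, ψ z ∂(μ.withDensity fun z => ENNReal.ofReal (g i z)) =
      ∫ z, g i z * ψ z ∂μ := by
    intro i
    rw [integral_withDensity_eq_integral_toReal_smul (hg i).ennreal_ofReal (by simp)]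
    refine integral_congr_ae (ae_of_all _ fun z => ?_)
    simp [ENNReal.toReal_ofReal (hg0 i z)]
  simp_rw [hpow]
  set N : ℝ := (Fintype.card ι : ℝ) with hN
  have hNpos : 0 < N := by rw [hN]; exact_mod_cast Fintype.card_pos
  -- With `L = S / N` the mixture likelihood ratio, `(L - 1) ψ ≤ |L - 1| ≤ δ / 2 + (L - 1)² / (2
  -- δ)`. This pointwise bound replaces Cauchy–Schwarz; it is multiplied by `N` and expanded so that
  -- it can be integrated term by term. When `E(L - 1)² ≤ δ²` it integrates to at most `δ`.
  have hpt : ∀ z, (∑ i, g i z * ψ z) ≤ N * ψ z + (N * (δ / 2 + 1 / (2 * δ)) +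
      (1 / (2 * δ * N)) * (∑ i, ∑ j, g i z * g j z) - (1 / δ) * ∑ i, g i z) := by
    intro z
    rw [← Finset.sum_mul, ← Finset.sum_mul_sum]
    set S := ∑ i, g i z
    obtain ⟨h0, h1⟩ := hψ01 z
    have key : (S / N - 1) * ψ z ≤ δ / 2 + (S / N - 1) ^ 2 / (2 * δ) := by
      have h2 : (S / N - 1) * ψ z ≤ |S / N - 1| := by
        calc (S / N - 1) * ψ z ≤ |S / N - 1| * ψ z :=
              mul_le_mul_of_nonneg_right (le_abs_self _) h0
          _ ≤ |S / N - 1| * 1 := mul_le_mul_of_nonneg_left h1 (abs_nonneg _)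
          _ = _ := mul_one _
      refine h2.trans ?_
      have h3 : δ / 2 + (S / N - 1) ^ 2 / (2 * δ) - |S / N - 1| =
          (δ - |S / N - 1|) ^ 2 / (2 * δ) := by
        rw [← sq_abs (S / N - 1)]
        field_simp
        ring
      have h4 : 0 ≤ (δ - |S / N - 1|) ^ 2 / (2 * δ) := by positivity
      linarith
    have h5 := mul_le_mul_of_nonneg_left key hNpos.le
    have h6 : N * ((S / N - 1) * ψ z) = S * ψ z - N * ψ z := by field_simp
    have h7 : N * (δ / 2 + (S / N - 1) ^ 2 / (2 * δ)) = N * (δ / 2 + 1 / (2 * δ)) +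
        (1 / (2 * δ * N)) * (S * S) - (1 / δ) * S := by
      field_simp
      ring
    linarith
  have hi1 : Integrable (fun z => ∑ i, ∑ j, g i z * g j z) μ :=
    integrable_finsetSum _ fun i _ => integrable_finsetSum _ fun j _ => hKi i j
  have hi2 : Integrable (fun z => ∑ i, g i z) μ := integrable_finsetSum _ fun i _ => hgi i
  have hint := integral_mono (integrable_finsetSum _ fun i _ => hgψ i)
    ((hψi.const_mul N).add (((integrable_const (N * (δ / 2 + 1 / (2 * δ)))).add
      (hi1.const_mul (1 / (2 * δ * N)))).sub (hi2.const_mul (1 / δ)))) hpt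
  have e1 : ∫ z, (N * ψ z + (N * (δ / 2 + 1 / (2 * δ)) +
      (1 / (2 * δ * N)) * (∑ i, ∑ j, g i z * g j z) - (1 / δ) * ∑ i, g i z)) ∂μ =
      N * (∫ z, ψ z ∂μ) + (N * (δ / 2 + 1 / (2 * δ)) +
      (1 / (2 * δ * N)) * (∑ i, ∑ j, K i j) - (1 / δ) * N) := by
    have j1 : Integrable (fun z => N * (δ / 2 + 1 / (2 * δ)) +
        (1 / (2 * δ * N)) * (∑ i, ∑ j, g i z * g j z)) μ :=
      (integrable_const _).add (hi1.const_mul _)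
    have j2 : Integrable (fun z => N * (δ / 2 + 1 / (2 * δ)) +
        (1 / (2 * δ * N)) * (∑ i, ∑ j, g i z * g j z) - (1 / δ) * ∑ i, g i z) μ :=
      j1.sub (hi2.const_mul _)
    rw [integral_add (hψi.const_mul N) j2, integral_sub j1 (hi2.const_mul _), integral_add (integrable_const _) (hi1.const_mul _),
      integral_const_mul, integral_const_mul, integral_const_mul, integral_const_mul,
      integral_finsetSum _ fun i _ => hgi i,
      integral_finsetSum _ fun i _ => integrable_finsetSum _ fun j _ => hKi i j]
    simp_rw [integral_finsetSum _ fun j (_ : j ∈ Finset.univ) => hKi _ j, hKI, hgI]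
    simp [hN]
  have hle : ∑ i, ∫ z, g i z * ψ z ∂μ ≤ N * (∫ z, ψ z ∂μ + δ) := by
    rw [← integral_finsetSum _ fun i _ => hgψ i]
    refine (hint.trans_eq e1).trans ?_
    have h8 : (1 / (2 * δ * N)) * (∑ i, ∑ j, K i j) ≤
        (1 / (2 * δ * N)) * (N ^ 2 * (1 + δ ^ 2)) :=
      mul_le_mul_of_nonneg_left hsum (by positivity)
    have h9 : N * (δ / 2 + 1 / (2 * δ)) + (1 / (2 * δ * N)) * (N ^ 2 * (1 + δ ^ 2)) - (1 / δ) * N =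
        N * δ := by
      field_simp
      ring
    linarith
  -- Some alternative has power at most the average over the mixture.
  obtain ⟨i, -, hi⟩ := Finset.exists_le_of_sum_le (s := Finset.univ)
    (f := fun i => ∫ z, g i z * ψ z ∂μ) (g := fun _ => ∫ z, ψ z ∂μ + δ) Finset.univ_nonempty
    (by simpa [hN, mul_add] using hle)
  exact ⟨i, hi⟩

/-- The parameter with regression vector `b` on the tested covariates, standard Gaussian design and
residual standard deviation `σ`. -/
noncomputable def isoParam {t : ℕ} (s : ℕ) (b : EuclideanSpace ℝ (Fin t)) (σ : ℝ) : Param t s :=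
  ⟨b, 0, 1, σ⟩

/-! ### One observation under isotropic design -/

section IsoParam

variable {t s : ℕ}

/-- The vector `b` extended by zero to all covariates. -/
noncomputable def extendZero (s : ℕ) (b : EuclideanSpace ℝ (Fin t)) : Covariate t s :=
  WithLp.toLp 2 (Sum.elim b 0)

theorem inner_extendZero (b b' : EuclideanSpace ℝ (Fin t)) :
    inner ℝ (extendZero s b) (extendZero s b') = inner ℝ b b' := by
  simp [extendZero, PiLp.inner_apply]

theorem norm_extendZero (b : EuclideanSpace ℝ (Fin t)) : ‖extendZero s b‖ = ‖b‖ := by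
  rw [← sq_eq_sq₀ (norm_nonneg _) (norm_nonneg _), ← real_inner_self_eq_norm_sq,
    ← real_inner_self_eq_norm_sq, inner_extendZero]

theorem regression_isoParam (b : EuclideanSpace ℝ (Fin t)) (σ : ℝ) (x : Covariate t s) :
    (isoParam s b σ).regression x = inner ℝ (extendZero s b) x := by
  simp [isoParam, Param.regression, extendZero, PiLp.inner_apply]

theorem signal_isoParam (b : EuclideanSpace ℝ (Fin t)) (σ : ℝ) :
    (isoParam s b σ).signal = b := by
  simp only [isoParam, Param.signal, Param.condCov]
  rw [← Matrix.fromBlocks_one, Matrix.toBlocks_fromBlocks₁₁, Matrix.toBlocks_fromBlocks₁₂]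
  simp

theorem isoParam_mem_paramSpace {M₀ M₁ M₂ : ℝ} (hM₀ : 1 ≤ M₀) {b : EuclideanSpace ℝ (Fin t)}
    {σ : ℝ} (hσ : 0 < σ) (hσ' : σ ≤ M₁) (hb : ‖b‖ ^ 2 ≤ M₂) :
    isoParam s b σ ∈ paramSpace M₀ M₁ M₂ t s := by
  have h : (1 : Matrix (Fin t ⊕ Fin s) (Fin t ⊕ Fin s) ℝ).IsHermitian := Matrix.isHermitian_one
  refine ⟨⟨h, fun i => ?_⟩, hσ, hσ', by simpa [isoParam] using hb⟩
  have hev : h.eigenvalues i = 1 := by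
    have hmul := h.mulVec_eigenvectorBasis i
    rw [Matrix.one_mulVec] at hmul
    have hne : (h.eigenvectorBasis i : (Fin t ⊕ Fin s) → ℝ) ≠ 0 := fun h0 =>
      h.eigenvectorBasis.orthonormal.ne_zero i (by ext j; exact congrFun h0 j)
    obtain ⟨j, hj⟩ := Function.ne_iff.1 hne
    have := congrFun hmul j
    simp only [Pi.smul_apply, smul_eq_mul] at this
    exact (mul_right_cancel₀ hj (by rw [one_mul]; exact this)).symm
  change M₀⁻¹ ≤ h.eigenvalues i ∧ h.eigenvalues i ≤ M₀
  rw [hev]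
  exact ⟨inv_le_one_of_one_le₀ hM₀, hM₀⟩

/-- The likelihood ratio of `b` against `0` for one observation. -/
noncomputable def obsRatio (b : EuclideanSpace ℝ (Fin t)) (v v₀ : ℝ) (p : Covariate t s × ℝ) : ℝ :=
  gaussianRatio v v₀ (inner ℝ (extendZero s b) p.1) p.2

theorem measurable_obsRatio (b : EuclideanSpace ℝ (Fin t)) (v v₀ : ℝ) :
    Measurable (obsRatio (s := s) b v v₀) := by
  unfold obsRatio gaussianRatio
  fun_prop

theorem lintegral_obsLaw_isoParam (b : EuclideanSpace ℝ (Fin t)) (σ : ℝ)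
    {f : Covariate t s × ℝ → ENNReal} (hf : Measurable f) :
    ∫⁻ p, f p ∂(isoParam s b σ).obsLaw =
      ∫⁻ x, ∫⁻ y, f (x, y) ∂(gaussianReal (inner ℝ (extendZero s b) x) (σ ^ 2).toNNReal)
        ∂(stdGaussian (Covariate t s)) := by
  rw [Param.obsLaw, Measure.lintegral_compProd hf]
  change ∫⁻ x, ∫⁻ y, f (x, y) ∂(gaussianReal ((isoParam s b σ).regression x) (σ ^ 2).toNNReal)
    ∂(multivariateGaussian 0 (1 : Matrix (Fin t ⊕ Fin s) (Fin t ⊕ Fin s) ℝ)) = _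
  rw [multivariateGaussian_zero_one]
  simp_rw [regression_isoParam]

theorem lintegral_obsLaw_isoParam_zero (σ : ℝ) {f : Covariate t s × ℝ → ENNReal}
    (hf : Measurable f) :
    ∫⁻ p, f p ∂(isoParam s (0 : EuclideanSpace ℝ (Fin t)) σ).obsLaw =
      ∫⁻ x, ∫⁻ y, f (x, y) ∂(gaussianReal 0 (σ ^ 2).toNNReal)
        ∂(stdGaussian (Covariate t s)) := by
  rw [lintegral_obsLaw_isoParam _ _ hf]
  have h0 : extendZero s (0 : EuclideanSpace ℝ (Fin t)) = 0 := by
    rw [← norm_eq_zero, norm_extendZero, norm_zero]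
  simp_rw [h0, inner_zero_left]

theorem obsLaw_isoParam_eq_withDensity (b : EuclideanSpace ℝ (Fin t)) {σ σ₀ : ℝ} (hσ : 0 < σ)
    (hσ₀ : 0 < σ₀) :
    (isoParam s b σ).obsLaw = (isoParam s (0 : EuclideanSpace ℝ (Fin t)) σ₀).obsLaw.withDensity
      fun p => ENNReal.ofReal (obsRatio b (σ ^ 2) (σ₀ ^ 2) p) := by
  have hm := (measurable_obsRatio (s := s) b (σ ^ 2) (σ₀ ^ 2)).ennreal_ofReal
  refine Measure.ext_of_lintegral _ fun f hf => ?_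
  rw [lintegral_withDensity_eq_lintegral_mul _ hm hf, lintegral_obsLaw_isoParam _ _ hf,
    lintegral_obsLaw_isoParam_zero _ (hm.mul hf)]
  refine lintegral_congr fun x => ?_
  have hv : (σ ^ 2).toNNReal ≠ 0 := by simpa using hσ.ne'
  have hv₀ : (σ₀ ^ 2).toNNReal ≠ 0 := by simpa using hσ₀.ne'
  rw [gaussianReal_eq_withDensity hv hv₀,
    lintegral_withDensity_eq_lintegral_mul _ _ (by fun_prop)]
  · simp [obsRatio, Real.coe_toNNReal _ (sq_nonneg _)]
  · unfold gaussianRatio; fun_prop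

/-- The hypotheses `hb`, `hb'` say that the response has marginal variance `σ₀²` under both
alternatives, as under the null. -/
theorem lintegral_obsRatio_mul {b b' : EuclideanSpace ℝ (Fin t)} {σ σ₀ : ℝ} (hσ : 0 < σ)
    (hb : ‖b‖ ^ 2 = σ₀ ^ 2 - σ ^ 2) (hb' : ‖b'‖ ^ 2 = σ₀ ^ 2 - σ ^ 2) :
    ∫⁻ p, ENNReal.ofReal (obsRatio b (σ ^ 2) (σ₀ ^ 2) p) *
        ENNReal.ofReal (obsRatio b' (σ ^ 2) (σ₀ ^ 2) p)
        ∂(isoParam s (0 : EuclideanSpace ℝ (Fin t)) σ₀).obsLaw =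
      ENNReal.ofReal (σ₀ ^ 2 / (σ₀ ^ 2 - inner ℝ b b')) := by
  have hm : Measurable fun p : Covariate t s × ℝ =>
      ENNReal.ofReal (obsRatio b (σ ^ 2) (σ₀ ^ 2) p) *
        ENNReal.ofReal (obsRatio b' (σ ^ 2) (σ₀ ^ 2) p) :=
    (measurable_obsRatio _ _ _).ennreal_ofReal.mul (measurable_obsRatio _ _ _).ennreal_ofReal
  rw [lintegral_obsLaw_isoParam_zero _ hm]
  have h := lintegral_gaussianRatio_mul_stdGaussian (E := Covariate t s)
    (v := (σ ^ 2).toNNReal) (v₀ := (σ₀ ^ 2).toNNReal) (b := extendZero s b)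
    (b' := extendZero s b') (Real.toNNReal_pos.2 (by positivity))
    (by simpa [norm_extendZero, Real.coe_toNNReal _ (sq_nonneg _)] using hb)
    (by simpa [norm_extendZero, Real.coe_toNNReal _ (sq_nonneg _)] using hb')
  simpa [obsRatio, inner_extendZero, Real.coe_toNNReal _ (sq_nonneg _)] using h

end IsoParam

/-! ### The sample of size `n` and the reduction to a sum over pairs -/

section Sample

variable {t s : ℕ}

/-- The likelihood ratio of `b` against `0` for `n` observations. -/
noncomputable def sampleRatio {n : ℕ} (b : EuclideanSpace ℝ (Fin t)) (v v₀ : ℝ)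
    (z : Fin n → Covariate t s × ℝ) : ℝ :=
  ∏ k, obsRatio b v v₀ (z k)

theorem obsRatio_nonneg (b : EuclideanSpace ℝ (Fin t)) (v v₀ : ℝ) (p : Covariate t s × ℝ) :
    0 ≤ obsRatio b v v₀ p :=
  gaussianRatio_nonneg _ _ _ _

theorem ofReal_sampleRatio {n : ℕ} (b : EuclideanSpace ℝ (Fin t)) (v v₀ : ℝ)
    (z : Fin n → Covariate t s × ℝ) :
    ENNReal.ofReal (sampleRatio b v v₀ z) = ∏ k, ENNReal.ofReal (obsRatio b v v₀ (z k)) :=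
  ENNReal.ofReal_prod_of_nonneg fun _ _ => obsRatio_nonneg _ _ _ _

theorem sampleLaw_isoParam_eq_withDensity (n : ℕ) (b : EuclideanSpace ℝ (Fin t)) {σ σ₀ : ℝ}
    (hσ : 0 < σ) (hσ₀ : 0 < σ₀) :
    (isoParam s b σ).sampleLaw n =
      ((isoParam s (0 : EuclideanSpace ℝ (Fin t)) σ₀).sampleLaw n).withDensity
        fun z => ENNReal.ofReal (sampleRatio b (σ ^ 2) (σ₀ ^ 2) z) := by
  have h := obsLaw_isoParam_eq_withDensity (s := s) b hσ hσ₀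
  have : IsProbabilityMeasure ((isoParam s (0 : EuclideanSpace ℝ (Fin t)) σ₀).obsLaw.withDensity
      fun p => ENNReal.ofReal (obsRatio b (σ ^ 2) (σ₀ ^ 2) p)) := h ▸ inferInstance
  simp_rw [ofReal_sampleRatio]
  rw [Param.sampleLaw, Param.sampleLaw,
    ← pi_withDensity _ (measurable_obsRatio b (σ ^ 2) (σ₀ ^ 2)).ennreal_ofReal]
  simp_rw [h]

/-- The worst-case power is at most `β` as soon as the mixture over a finite family of alternatives
with isotropic design has small `χ²`-divergence from the null law with the same marginals. -/
theorem maximinPower_le_of_sum_le {n : ℕ} {α β σ₀ r : ℝ} {null alt : Set (Param t s)}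
    (hαβ : α < β) (hσ₀ : 0 < σ₀) (hr : r ^ 2 < σ₀ ^ 2)
    (hnull : isoParam s (0 : EuclideanSpace ℝ (Fin t)) σ₀ ∈ null)
    {ι : Type*} [Fintype ι] [Nonempty ι] {b : ι → EuclideanSpace ℝ (Fin t)}
    (hb : ∀ i, ‖b i‖ ^ 2 = r ^ 2) (halt : ∀ i, isoParam s (b i) √(σ₀ ^ 2 - r ^ 2) ∈ alt)
    (hsum : ∑ i, ∑ j, (σ₀ ^ 2 / (σ₀ ^ 2 - inner ℝ (b i) (b j))) ^ n ≤
      (Fintype.card ι : ℝ) ^ 2 * (1 + (β - α) ^ 2)) :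
    maximinPower n α null alt ≤ (β : EReal) := by
  set σ : ℝ := √(σ₀ ^ 2 - r ^ 2) with hσdef
  have hσ : 0 < σ := Real.sqrt_pos.2 (by linarith)
  have hσ2 : σ ^ 2 = σ₀ ^ 2 - r ^ 2 := Real.sq_sqrt (by linarith)
  have hb' : ∀ i, ‖b i‖ ^ 2 = σ₀ ^ 2 - σ ^ 2 := fun i => by rw [hb, hσ2]; ring
  have hinner : ∀ i j, inner ℝ (b i) (b j) ≤ r ^ 2 := by
    intro i j
    have hij : ‖b i‖ = ‖b j‖ := by
      rw [← sq_eq_sq₀ (norm_nonneg _) (norm_nonneg _), hb, hb]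
    calc inner ℝ (b i) (b j) ≤ ‖b i‖ * ‖b j‖ := real_inner_le_norm _ _
      _ = r ^ 2 := by rw [hij, ← sq, hb]
  have hmeas : ∀ i, Measurable fun z : Fin n → Covariate t s × ℝ =>
      sampleRatio (b i) (σ ^ 2) (σ₀ ^ 2) z := fun i =>
    Finset.measurable_prod _ fun k _ =>
      (measurable_obsRatio (b i) (σ ^ 2) (σ₀ ^ 2)).comp (measurable_pi_apply k)
  have hinst : ∀ θ : Param t s, IsProbabilityMeasure (θ.sampleLaw n) := fun θ => by
    unfold Param.sampleLaw; infer_instance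
  refine iSup₂_le fun ψ hψ => ?_
  obtain ⟨hψm, hψ01, hlevel⟩ := hψ
  obtain ⟨i, hi⟩ := exists_integral_withDensity_le
    ((isoParam s (0 : EuclideanSpace ℝ (Fin t)) σ₀).sampleLaw n)
    (g := fun i z => sampleRatio (b i) (σ ^ 2) (σ₀ ^ 2) z) hmeas
    (fun i z => Finset.prod_nonneg fun k _ => obsRatio_nonneg _ _ _ _)
    -- The likelihood ratio has integral one because it is the density of a probability law; no
    -- integral is computed.
    (fun i => by
      have h := measure_univ (μ := (isoParam s (b i) σ).sampleLaw n)
      rwa [sampleLaw_isoParam_eq_withDensity n (b i) hσ hσ₀, withDensity_apply _ .univ,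
        Measure.restrict_univ] at h)
    (K := fun i j => (σ₀ ^ 2 / (σ₀ ^ 2 - inner ℝ (b i) (b j))) ^ n)
    (fun i j => pow_nonneg (div_nonneg (sq_nonneg _) (by linarith [hinner i j])) _)
    (fun i j => by
      simp_rw [ofReal_sampleRatio, ← Finset.prod_mul_distrib]
      rw [Param.sampleLaw, lintegral_pi_prod (ι := Fin n) _
        (f := fun _ p => ENNReal.ofReal (obsRatio (b i) (σ ^ 2) (σ₀ ^ 2) p) *
          ENNReal.ofReal (obsRatio (b j) (σ ^ 2) (σ₀ ^ 2) p))
        fun _ => (measurable_obsRatio _ _ _).ennreal_ofReal.mul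
          (measurable_obsRatio _ _ _).ennreal_ofReal]
      simp_rw [lintegral_obsRatio_mul hσ (hb' i) (hb' j)]
      rw [Finset.prod_const, Finset.card_univ, Fintype.card_fin, ENNReal.ofReal_pow]
      exact div_nonneg (sq_nonneg _) (by linarith [hinner i j]))
    (sub_pos.2 hαβ) hsum hψm hψ01
  refine (iInf₂_le (isoParam s (b i) σ) (halt i)).trans ?_
  rw [EReal.coe_le_coe_iff, sampleLaw_isoParam_eq_withDensity n (b i) hσ hσ₀]
  have := hlevel _ hnull
  linarith

end Sample

/-! ### Bounds for powers of `(1 - x)⁻¹` and for Rademacher sums -/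

/-- First-order Taylor expansion of `log (1 - x)`, with remainder at most `x² / (1 - |x|) ≤ 2 x²`.
-/
theorem inv_one_sub_le_exp {x : ℝ} (hx : |x| ≤ 1 / 2) :
    (1 - x)⁻¹ ≤ Real.exp (x + 2 * x ^ 2) := by
  obtain ⟨h1, h2⟩ := abs_le.1 hx
  have hpos : 0 < 1 - x := by linarith
  have h := Real.abs_log_sub_add_sum_range_le (lt_of_le_of_lt hx (by norm_num)) 1
  simp only [Finset.sum_range_one, zero_add, pow_one, Nat.cast_zero, div_one, one_add_one_eq_two,
    sq_abs] at h
  have h3 : x ^ 2 / (1 - |x|) ≤ 2 * x ^ 2 := by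
    rw [div_le_iff₀ (by linarith)]
    nlinarith [sq_nonneg x]
  have h4 := neg_le_of_abs_le h
  rw [← Real.exp_log hpos, ← Real.exp_neg, Real.exp_le_exp]
  linarith

/-- A cruder bound, enough for the sparse case, where no cancellation of the linear term is
available. -/
theorem inv_one_sub_pow_le_exp {x : ℝ} (hx0 : 0 ≤ x) (hx : x ≤ 1 / 2) (n : ℕ) :
    ((1 - x)⁻¹) ^ n ≤ Real.exp (2 * (n * x)) := by
  have h := inv_one_sub_le_exp (x := x) (by rw [abs_of_nonneg hx0]; exact hx)
  calc ((1 - x)⁻¹) ^ n ≤ (Real.exp (x + 2 * x ^ 2)) ^ n :=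
        pow_le_pow_left₀ (inv_nonneg.2 (by linarith)) h n
    _ = Real.exp (n * (x + 2 * x ^ 2)) := by rw [← Real.exp_nat_mul]
    _ ≤ _ := by
      apply Real.exp_le_exp.2
      have : x + 2 * x ^ 2 ≤ 2 * x := by nlinarith
      have := mul_le_mul_of_nonneg_left this (Nat.cast_nonneg (α := ℝ) n)
      linarith

theorem exp_le_one_add_add_sq_mul (w : ℝ) : Real.exp w ≤ 1 + w + w ^ 2 * Real.exp |w| := by
  have h1 := Real.add_one_le_exp w
  have h2 : Real.exp w - 1 ≤ w * Real.exp w := by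
    have h := mul_le_mul_of_nonneg_left (Real.add_one_le_exp (-w)) (Real.exp_nonneg w)
    rw [← Real.exp_add, add_neg_cancel, Real.exp_zero] at h
    linarith
  -- Start from `exp w ≤ 1 + w exp w`. For `w ≥ 0` the same inequality is applied again to the
  -- factor `exp w`; for `w ≤ 0` multiplying `1 + w ≤ exp w` by `w` gives `w exp w ≤ w + w²`.
  rcases le_total 0 w with hw | hw
  · rw [abs_of_nonneg hw]
    have h4 := mul_le_mul_of_nonneg_left h2 hw
    linarith
  · have h3 : 1 ≤ Real.exp |w| := Real.one_le_exp (abs_nonneg w)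
    have h4 := mul_le_mul_of_nonneg_left h3 (sq_nonneg w)
    have h5 := mul_le_mul_of_nonpos_left h1 hw
    linarith

/-- The linear term `n x` is kept with exact coefficient because it will sum to zero over the signs.
The constant is `6 = 2 + 4`: `2` from `2 n x² ≤ 2 (n x)²`, and `4` from squaring an exponent of size
at most `2 |n x|`. -/
theorem inv_one_sub_pow_le {x : ℝ} (hx : |x| ≤ 1 / 2) (n : ℕ) :
    ((1 - x)⁻¹) ^ n ≤ 1 + n * x + 6 * (n * x) ^ 2 * Real.exp (2 * |n * x|) := by
  obtain ⟨h1, h2⟩ := abs_le.1 hx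
  have hn : (0 : ℝ) ≤ n := Nat.cast_nonneg n
  have hpow : ((1 - x)⁻¹) ^ n ≤ Real.exp (n * (x + 2 * x ^ 2)) :=
    calc ((1 - x)⁻¹) ^ n ≤ (Real.exp (x + 2 * x ^ 2)) ^ n :=
          pow_le_pow_left₀ (inv_nonneg.2 (by linarith)) (inv_one_sub_le_exp hx) n
      _ = _ := by rw [← Real.exp_nat_mul]
  refine hpow.trans ((exp_le_one_add_add_sq_mul _).trans ?_)
  have hw : (n : ℝ) * (x + 2 * x ^ 2) ≤ n * x + 2 * (n * x) ^ 2 := by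
    have hnn : (n : ℝ) ≤ n ^ 2 := by exact_mod_cast Nat.le_self_pow two_ne_zero n
    have := mul_le_mul_of_nonneg_right hnn (sq_nonneg x)
    linarith
  have habs : |(n : ℝ) * (x + 2 * x ^ 2)| ≤ 2 * |n * x| := by
    have h3 : |1 + 2 * x| ≤ 2 := abs_le.2 ⟨by linarith, by linarith⟩
    have h4 := mul_le_mul_of_nonneg_left h3 (abs_nonneg (n * x))
    rw [← abs_mul] at h4
    calc |(n : ℝ) * (x + 2 * x ^ 2)| = |n * x * (1 + 2 * x)| := by congr 1; ring
      _ ≤ |n * x| * 2 := h4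
      _ = _ := mul_comm _ _
  have hsq : ((n : ℝ) * (x + 2 * x ^ 2)) ^ 2 ≤ 4 * (n * x) ^ 2 := by
    have h5 := pow_le_pow_left₀ (abs_nonneg _) habs 2
    rw [sq_abs, mul_pow 2, sq_abs] at h5
    linarith
  have h6 : ((n : ℝ) * (x + 2 * x ^ 2)) ^ 2 * Real.exp |(n : ℝ) * (x + 2 * x ^ 2)| ≤
      4 * (n * x) ^ 2 * Real.exp (2 * |n * x|) :=
    mul_le_mul hsq (Real.exp_le_exp.2 habs) (Real.exp_nonneg _) (by positivity)
  have h7 : 1 ≤ Real.exp (2 * |n * x|) := Real.one_le_exp (by positivity)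
  have h8 := mul_le_mul_of_nonneg_left h7 (by positivity : 0 ≤ 2 * ((n : ℝ) * x) ^ 2)
  linarith

/-- For `y = a z` with `0 ≤ a ≤ 1/2`, the remainder in `inv_one_sub_pow_le` is dominated by
exponential moments of `z`. -/
theorem sq_mul_exp_abs_le {a : ℝ} (ha0 : 0 ≤ a) (ha : a ≤ 1 / 2) (z : ℝ) :
    (a * z) ^ 2 * Real.exp (2 * |a * z|) ≤
      2 * a ^ 2 * (Real.exp (2 * z) + Real.exp (-(2 * z))) := by
  have h1 : z ^ 2 ≤ 2 * Real.exp |z| := by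
    have h := Real.quadratic_le_exp_of_nonneg (abs_nonneg z)
    rw [sq_abs] at h
    linarith [abs_nonneg z]
  have h2 : Real.exp (2 * |a * z|) ≤ Real.exp |z| := by
    apply Real.exp_le_exp.2
    rw [abs_mul, abs_of_nonneg ha0]
    have := mul_le_mul_of_nonneg_right ha (abs_nonneg z)
    linarith
  have h3 : Real.exp |z| * Real.exp |z| ≤ Real.exp (2 * z) + Real.exp (-(2 * z)) := by
    rw [← Real.exp_add, ← two_mul]
    rcases abs_choice z with h | h <;> rw [h]
    · linarith [Real.exp_nonneg (-(2 * z))]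
    · rw [mul_neg]; linarith [Real.exp_nonneg (2 * z)]
  calc (a * z) ^ 2 * Real.exp (2 * |a * z|) ≤ (a ^ 2 * (2 * Real.exp |z|)) * Real.exp |z| := by
        rw [mul_pow]
        exact mul_le_mul (mul_le_mul_of_nonneg_left h1 (sq_nonneg a)) h2 (Real.exp_nonneg _)
          (by positivity)
    _ = 2 * a ^ 2 * (Real.exp |z| * Real.exp |z|) := by ring
    _ ≤ _ := mul_le_mul_of_nonneg_left h3 (by positivity)

/-- The sign attached to a Boolean. -/
def boolSign (x : Bool) : ℝ := if x then 1 else -1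

theorem boolSign_not (x : Bool) : boolSign (!x) = -boolSign x := by
  cases x <;> simp [boolSign]

theorem boolSign_sq (x : Bool) : boolSign x ^ 2 = 1 := by
  cases x <;> simp [boolSign]

/-- The sum factors over coordinates. Each factor is `2 cosh l ≤ 2 exp(l² / 2)`, whatever the sign
`w i`. -/
theorem sum_exp_boolSign_le {t : ℕ} (w : Fin t → Bool) (l : ℝ) :
    ∑ w' : Fin t → Bool, Real.exp (l * ∑ i, boolSign (w i) * boolSign (w' i)) ≤
      2 ^ t * Real.exp (t * (l ^ 2 / 2)) := by
  have h1 : ∀ w' : Fin t → Bool, Real.exp (l * ∑ i, boolSign (w i) * boolSign (w' i)) =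
      ∏ i, Real.exp (l * (boolSign (w i) * boolSign (w' i))) := fun w' => by
    rw [Finset.mul_sum, Real.exp_sum]
  simp_rw [h1]
  rw [← Fintype.prod_sum fun i x => Real.exp (l * (boolSign (w i) * boolSign x))]
  have h2 : ∀ i, ∑ x : Bool, Real.exp (l * (boolSign (w i) * boolSign x)) = 2 * Real.cosh l := by
    intro i
    rw [Fintype.sum_bool, Real.cosh_eq]
    cases w i <;> simp [boolSign] <;> ring
  simp_rw [h2]
  rw [Finset.prod_const, Finset.card_univ, Fintype.card_fin, mul_pow, Real.exp_nat_mul]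
  exact mul_le_mul_of_nonneg_left
    (pow_le_pow_left₀ (Real.cosh_pos l).le (Real.cosh_le_exp_half_sq l) t) (by positivity)

/-- Flipping all signs of `w'` is a bijection that negates the summand. -/
theorem sum_sum_boolSign_eq_zero {t : ℕ} (w : Fin t → Bool) :
    ∑ w' : Fin t → Bool, ∑ i, boolSign (w i) * boolSign (w' i) = 0 := by
  have h := Equiv.sum_comp (Equiv.piCongrRight fun _ : Fin t => Equiv.boolNot)
    fun w' : Fin t → Bool => ∑ i, boolSign (w i) * boolSign (w' i)
  have h2 : ∀ w' : Fin t → Bool, ∑ i, boolSign (w i) * boolSign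
      ((Equiv.piCongrRight fun _ : Fin t => Equiv.boolNot) w' i) =
      -∑ i, boolSign (w i) * boolSign (w' i) := fun w' => by
    simp [boolSign_not]
  simp_rw [h2, Finset.sum_neg_distrib] at h
  linarith

/-- The `χ²` bound for Rademacher vectors. -/
theorem sum_inv_one_sub_boolSign_pow_le {t n : ℕ} (ht : 1 ≤ t) (hn : 1 ≤ n) {a : ℝ} (ha0 : 0 ≤ a)
    (ha : a ≤ 1 / 2) (hat : a * √t ≤ n / 2) (w : Fin t → Bool) :
    ∑ w' : Fin t → Bool, ((1 - a / (n * √t) * ∑ i, boolSign (w i) * boolSign (w' i))⁻¹) ^ n ≤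
      2 ^ t * (1 + 24 * Real.exp 2 * a ^ 2) := by
  have ht' : (0 : ℝ) < t := by exact_mod_cast ht
  have hn' : (0 : ℝ) < n := by exact_mod_cast hn
  have hst : 0 < √(t : ℝ) := Real.sqrt_pos.2 ht'
  have hss : √(t : ℝ) * √t = t := Real.mul_self_sqrt ht'.le
  have hpt : ∀ w' : Fin t → Bool,
      ((1 - a / (n * √t) * ∑ i, boolSign (w i) * boolSign (w' i))⁻¹) ^ n ≤
        1 + a / √t * (∑ i, boolSign (w i) * boolSign (w' i)) +
        12 * a ^ 2 * (Real.exp (2 / √t * ∑ i, boolSign (w i) * boolSign (w' i)) +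
          Real.exp (-(2 / √t) * ∑ i, boolSign (w i) * boolSign (w' i))) := by
    intro w'
    set S := ∑ i, boolSign (w i) * boolSign (w' i) with hS
    have hSt : |S| ≤ t := by
      calc |S| ≤ ∑ i, |boolSign (w i) * boolSign (w' i)| := Finset.abs_sum_le_sum_abs _ _
        _ = ∑ _i : Fin t, (1 : ℝ) := Finset.sum_congr rfl fun i _ => by
          cases w i <;> cases w' i <;> simp [boolSign]
        _ = t := by simp
    -- The extreme case is `|S| = t`; `hat`, which stems from `t ≤ C₁ n²`, is what covers it.
    have hx : |a / (n * √t) * S| ≤ 1 / 2 := by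
      rw [abs_mul, abs_of_nonneg (by positivity)]
      calc a / (n * √t) * |S| ≤ a / (n * √t) * t :=
            mul_le_mul_of_nonneg_left hSt (by positivity)
        _ = a * √t / n := by
          nth_rewrite 2 [← hss]
          field_simp
        _ ≤ 1 / 2 := by
          rw [div_le_iff₀ hn']
          linarith
    have hy : n * (a / (n * √t) * S) = a * (S / √t) := by field_simp
    have h := inv_one_sub_pow_le hx n
    rw [hy] at h
    have h2 := sq_mul_exp_abs_le ha0 ha (S / √t)
    have e1 : a / √t * S = a * (S / √t) := by ring
    have e2 : 2 / √t * S = 2 * (S / √t) := by ring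
    have e3 : -(2 / √t) * S = -(2 * (S / √t)) := by ring
    rw [e1, e2, e3]
    linarith
  refine (Finset.sum_le_sum fun w' _ => hpt w').trans ?_
  rw [Finset.sum_add_distrib, Finset.sum_add_distrib, ← Finset.mul_sum, ← Finset.mul_sum,
    Finset.sum_add_distrib, sum_sum_boolSign_eq_zero]
  have h1 := sum_exp_boolSign_le w (2 / √t)
  have h2 := sum_exp_boolSign_le w (-(2 / √t))
  -- At the scale `2 / √t` the sub-Gaussian exponent is `2` for every `t`. The two exponential sums,
  -- each at most `2 ^ t * exp 2` and weighted by `12 a²`, give the constant `24 * exp 2`.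
  have e : (t : ℝ) * ((2 / √t) ^ 2 / 2) = 2 := by
    rw [div_pow, Real.sq_sqrt ht'.le]
    field_simp
  rw [neg_sq, e] at h2
  rw [e] at h1
  have hc : ∑ _w' : Fin t → Bool, (1 : ℝ) = 2 ^ t := by simp
  rw [hc, mul_zero, add_zero]
  have h3 := mul_le_mul_of_nonneg_left (add_le_add h1 h2) (by positivity : 0 ≤ 12 * a ^ 2)
  linarith

/-! ### The two families of alternatives: sign vectors and single coordinates -/

theorem exists_pos_sq_le {a b d : ℝ} (ha : 0 < a) (hb : 0 < b) (hd : 0 < d) :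
    ∃ c : ℝ, 0 < c ∧ c ^ 2 ≤ a ∧ c ^ 2 ≤ b ∧ c ^ 2 ≤ d := by
  have h : 0 < min a (min b d) := lt_min ha (lt_min hb hd)
  refine ⟨√(min a (min b d)), Real.sqrt_pos.2 h, ?_⟩
  rw [Real.sq_sqrt h.le]
  exact ⟨min_le_left _ _, (min_le_right _ _).trans (min_le_left _ _),
    (min_le_right _ _).trans (min_le_right _ _)⟩

theorem isoParam_zero_mem_nullSpace {M₀ M₁ M₂ : ℝ} (hM₀ : 1 < M₀) (hM₁ : 0 < M₁) (hM₂ : 0 < M₂)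
    (t s : ℕ) :
    isoParam s (0 : EuclideanSpace ℝ (Fin t)) M₁ ∈ nullSpace M₀ M₁ M₂ t s :=
  ⟨isoParam_mem_paramSpace hM₀.le hM₁ le_rfl (by simpa using hM₂.le), rfl⟩

theorem isoParam_sqrt_mem_paramSpace {M₀ M₁ M₂ h : ℝ} (hM₀ : 1 < M₀) (hM₁ : 0 < M₁)
    (hh : h ^ 2 < M₁ ^ 2) (hhM₂ : h ^ 2 ≤ M₂) {t s : ℕ} {b : EuclideanSpace ℝ (Fin t)}
    (hb : ‖b‖ ^ 2 = h ^ 2) :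
    isoParam s b √(M₁ ^ 2 - h ^ 2) ∈ paramSpace M₀ M₁ M₂ t s :=
  isoParam_mem_paramSpace hM₀.le (Real.sqrt_pos.2 (by linarith))
    ((Real.sqrt_le_left hM₁.le).2 (by nlinarith [sq_nonneg h])) (hb.trans_le hhM₂)

theorem div_sub_eq_inv_one_sub {m κ : ℝ} (hm : 0 < m) : m / (m - κ) = (1 - κ / m)⁻¹ := by
  rw [one_sub_div hm.ne', inv_div]

/-- The vector with all coordinates `± r / √t`. -/
noncomputable def signVector {t : ℕ} (r : ℝ) (w : Fin t → Bool) : EuclideanSpace ℝ (Fin t) :=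
  WithLp.toLp 2 fun i => r / √t * boolSign (w i)

theorem inner_signVector {t : ℕ} (r : ℝ) (w w' : Fin t → Bool) :
    inner ℝ (signVector r w) (signVector r w') =
      r ^ 2 / t * ∑ i, boolSign (w i) * boolSign (w' i) := by
  simp only [signVector, PiLp.inner_apply, Finset.mul_sum]
  refine Finset.sum_congr rfl fun i _ => ?_
  have h : √(t : ℝ) ^ 2 = t := Real.sq_sqrt (Nat.cast_nonneg t)
  simp only [RCLike.inner_apply, conj_trivial]
  generalize √(t : ℝ) = q at h ⊢
  rw [← h]
  ring

theorem norm_signVector_sq {t : ℕ} (ht : 1 ≤ t) (r : ℝ) (w : Fin t → Bool) :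
    ‖signVector r w‖ ^ 2 = r ^ 2 := by
  have ht' : (0 : ℝ) < t := by exact_mod_cast ht
  rw [← real_inner_self_eq_norm_sq, inner_signVector]
  simp_rw [← sq, boolSign_sq]
  simp
  field_simp

/-- The mixture is uniform over sign vectors whose norm is exactly the separation radius `r`. Here
`h1`, `h2` control the `χ²`-divergence, `h3` keeps `r² / M₁² ≤ 1 / 2`, and `h4` gives `r² ≤ M₂`. -/
theorem maximinPower_denseAlt_le {α β M₀ M₁ M₂ : ℝ} (hαβ : α < β) (hM₀ : 1 < M₀) (hM₁ : 0 < M₁)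
    (hM₂ : 0 < M₂) {t s n : ℕ} (ht : 1 ≤ t) (hn : 1 ≤ n) {c : ℝ} (hc : 0 < c)
    (h1 : c ^ 2 / M₁ ^ 2 ≤ 1 / 2) (h2 : 24 * Real.exp 2 * (c ^ 2 / M₁ ^ 2) ^ 2 ≤ (β - α) ^ 2)
    (h3 : c ^ 2 / M₁ ^ 2 * √t ≤ n / 2) (h4 : c ^ 2 * √t ≤ M₂ * n) :
    maximinPower n α (nullSpace M₀ M₁ M₂ t s)
      (denseAlt M₀ M₁ M₂ t s (c * (t : ℝ) ^ (1 / 4 : ℝ) / Real.sqrt n)) ≤ (β : EReal) := by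
  have ht' : (0 : ℝ) < t := by exact_mod_cast ht
  have hn' : (0 : ℝ) < n := by exact_mod_cast hn
  have hst : 0 < √(t : ℝ) := Real.sqrt_pos.2 ht'
  have hm : 0 < M₁ ^ 2 := by positivity
  set r : ℝ := c * (t : ℝ) ^ (1 / 4 : ℝ) / Real.sqrt n with hr
  have hr0 : 0 ≤ r := by positivity
  have hr2 : r ^ 2 = c ^ 2 * √t / n := by
    rw [hr, div_pow, mul_pow, Real.sq_sqrt hn'.le, ← Real.rpow_natCast, ← Real.rpow_natCast,
      ← Real.rpow_mul ht'.le, Real.sqrt_eq_rpow]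
    norm_num
  have hrM : r ^ 2 < M₁ ^ 2 := by
    have h5 : c ^ 2 * √t ≤ M₁ ^ 2 * (n / 2) := by
      rw [div_mul_eq_mul_div, div_le_iff₀ hm] at h3
      linarith
    rw [hr2, div_lt_iff₀ hn']
    nlinarith
  have hrM₂ : r ^ 2 ≤ M₂ := by rw [hr2, div_le_iff₀ hn']; exact h4
  refine maximinPower_le_of_sum_le (ι := Fin t → Bool) (b := signVector r) hαβ hM₁ hrM
    (isoParam_zero_mem_nullSpace hM₀ hM₁ hM₂ t s) (norm_signVector_sq ht r) (fun w => ⟨?_, ?_⟩) ?_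
  · exact isoParam_sqrt_mem_paramSpace hM₀ hM₁ hrM hrM₂ (norm_signVector_sq ht r w)
  · rw [signal_isoParam]
    exact (abs_le_of_sq_le_sq' (norm_signVector_sq ht r w).ge (norm_nonneg _)).2
  · have hK : ∀ w w' : Fin t → Bool,
        M₁ ^ 2 / (M₁ ^ 2 - inner ℝ (signVector r w) (signVector r w')) =
        (1 - c ^ 2 / M₁ ^ 2 / (n * √t) * ∑ i, boolSign (w i) * boolSign (w' i))⁻¹ := by
      intro w w'
      rw [div_sub_eq_inv_one_sub hm, inner_signVector, hr2]
      congr 2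
      have h : √(t : ℝ) ^ 2 = t := Real.sq_sqrt ht'.le
      rw [div_div (c ^ 2 * √t), ← h, Real.sqrt_sq hst.le]
      field_simp
    simp_rw [hK]
    refine (Finset.sum_le_sum fun w _ => (sum_inv_one_sub_boolSign_pow_le ht hn (by positivity) h1
      h3 w)).trans ?_
    have hcard : (Fintype.card (Fin t → Bool) : ℝ) = 2 ^ t := by simp
    rw [Finset.sum_const, Finset.card_univ, nsmul_eq_mul, hcard, pow_two ((2 : ℝ) ^ t), mul_assoc ((2 : ℝ) ^ t)]
    have : (1 : ℝ) + 24 * Real.exp 2 * (c ^ 2 / M₁ ^ 2) ^ 2 ≤ 1 + (β - α) ^ 2 := by linarith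
    gcongr

/-- The mixture is uniform over the vectors `r eᵢ`. Off-diagonal kernel entries equal `1`, so the
excess of the double sum over `t²` is `t (D - 1)`, and `D - 1 ≤ (β - α)² t` suffices. -/
theorem maximinPower_sparseAlt_le {α β M₀ M₁ M₂ : ℝ} (hαβ : α < β) (hM₀ : 1 < M₀) (hM₁ : 0 < M₁)
    (hM₂ : 0 < M₂) {t s n : ℕ} (ht : 1 ≤ t) (hn : 1 ≤ n) {c : ℝ} (hc : 0 < c)
    (h1 : 2 * (c ^ 2 / M₁ ^ 2) ≤ 1) (h2 : 2 * (c ^ 2 / M₁ ^ 2) ≤ (β - α) ^ 2)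
    (h3 : c ^ 2 / M₁ ^ 2 * Real.log t ≤ n / 2) (h4 : c ^ 2 * Real.log t ≤ M₂ * n) :
    maximinPower n α (nullSpace M₀ M₁ M₂ t s)
      (sparseAlt M₀ M₁ M₂ t s (c * Real.sqrt (Real.log t / n))) ≤ (β : EReal) := by
  have ht1 : (1 : ℝ) ≤ t := by exact_mod_cast ht
  have ht' : (0 : ℝ) < t := by exact_mod_cast ht
  have hn' : (0 : ℝ) < n := by exact_mod_cast hn
  have hm : 0 < M₁ ^ 2 := by positivity
  have hlog : 0 ≤ Real.log t := Real.log_nonneg ht1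
  set r : ℝ := c * Real.sqrt (Real.log t / n) with hr
  have hr0 : 0 ≤ r := by positivity
  have hr2 : r ^ 2 = c ^ 2 * Real.log t / n := by
    rw [hr, mul_pow, Real.sq_sqrt (by positivity), mul_div_assoc]
  have hrM' : r ^ 2 / M₁ ^ 2 ≤ 1 / 2 := by
    rw [hr2, div_div, div_le_iff₀ (by positivity)]
    rw [div_mul_eq_mul_div, div_le_iff₀ hm] at h3
    linarith
  have hrM : r ^ 2 < M₁ ^ 2 := by
    rw [div_le_iff₀ hm] at hrM'
    linarith
  have hrM₂ : r ^ 2 ≤ M₂ := by rw [hr2, div_le_iff₀ hn']; exact h4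
  have : Nonempty (Fin t) := ⟨⟨0, ht⟩⟩
  have hnorm : ∀ i : Fin t, ‖EuclideanSpace.single i r‖ ^ 2 = r ^ 2 := fun i => by
    rw [PiLp.norm_single, Real.norm_eq_abs, sq_abs]
  refine maximinPower_le_of_sum_le (ι := Fin t) (b := fun i => EuclideanSpace.single i r) hαβ hM₁
    hrM (isoParam_zero_mem_nullSpace hM₀ hM₁ hM₂ t s) hnorm (fun i => ⟨?_, ?_⟩) ?_
  · exact isoParam_sqrt_mem_paramSpace hM₀ hM₁ hrM hrM₂ (hnorm i)
  · rw [signal_isoParam]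
    calc r = (EuclideanSpace.single i r : EuclideanSpace ℝ (Fin t)) i := by simp
      _ ≤ ‖(EuclideanSpace.single i r : EuclideanSpace ℝ (Fin t)) i‖ := Real.le_norm_self _
      _ ≤ _ := norm_le_pi_norm (EuclideanSpace.single i r : EuclideanSpace ℝ (Fin t)).ofLp i
  · set D : ℝ := ((1 - r ^ 2 / M₁ ^ 2)⁻¹) ^ n with hD
    have hK : ∀ i j : Fin t, (M₁ ^ 2 / (M₁ ^ 2 - inner ℝ
        (EuclideanSpace.single i r : EuclideanSpace ℝ (Fin t)) (EuclideanSpace.single j r))) ^ n =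
        1 + if i = j then D - 1 else 0 := by
      intro i j
      rw [div_sub_eq_inv_one_sub hm, EuclideanSpace.inner_single_left, PiLp.single_apply]
      by_cases hij : i = j
      · simp [hij, hD, sq]
      · simp [hij]
    simp_rw [hK, Finset.sum_add_distrib, Finset.sum_ite_eq, Finset.mem_univ, if_true]
    simp only [Finset.sum_const, Finset.card_univ, Fintype.card_fin, nsmul_eq_mul, mul_one]
    have hDle : D ≤ 1 + 2 * (c ^ 2 / M₁ ^ 2) * (t - 1) := by
      calc D ≤ Real.exp (2 * (n * (r ^ 2 / M₁ ^ 2))) :=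
            inv_one_sub_pow_le_exp (by positivity) hrM' n
        -- The exponential is a power of `t` with exponent at most `1`, by `h1`; Bernoulli's
        -- inequality for such exponents makes it linear in `t - 1`, including at `t = 1`.
        _ = (1 + (t - 1 : ℝ)) ^ (2 * (c ^ 2 / M₁ ^ 2)) := by
          rw [add_sub_cancel, Real.rpow_def_of_pos ht', hr2]
          congr 1
          field_simp
        _ ≤ _ := rpow_one_add_le_one_add_mul_self (by linarith) (by positivity) h1
    have h5 : D - 1 ≤ (β - α) ^ 2 * t := by
      calc D - 1 ≤ 2 * (c ^ 2 / M₁ ^ 2) * (t - 1) := by linarith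
        _ ≤ (β - α) ^ 2 * (t - 1) := mul_le_mul_of_nonneg_right h2 (by linarith)
        _ ≤ (β - α) ^ 2 * t := mul_le_mul_of_nonneg_left (by linarith) (sq_nonneg _)
    have h6 := mul_le_mul_of_nonneg_left h5 ht'.le
    linarith

end CondTest

/-! ### Choice of the constants -/

theorem mainTheorem4 (α β M₀ M₁ M₂ : ℝ) (hα : 0 < α) (hαβ : α < β) (hβ : β < 1)
    (hM₀ : 1 < M₀) (hM₁ : 0 < M₁) (hM₂ : 0 < M₂) :
    (∀ C₁ : ℝ, 0 < C₁ → ∃ c₃ : ℝ, 0 < c₃ ∧ ∀ t s : ℕ → ℕ,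
      (∀ᶠ n in atTop, 1 ≤ t n ∧ (t n : ℝ) ≤ C₁ * (n : ℝ) ^ 2) →
      limsup (fun n : ℕ => CondTest.maximinPower n α
        (CondTest.nullSpace M₀ M₁ M₂ (t n) (s n))
        (CondTest.denseAlt M₀ M₁ M₂ (t n) (s n)
          (c₃ * (t n : ℝ) ^ (1 / 4 : ℝ) / Real.sqrt n))) atTop ≤ (β : EReal)) ∧
    (∀ C₂ : ℝ, 0 < C₂ → ∃ c₄ : ℝ, 0 < c₄ ∧ ∀ t s : ℕ → ℕ,
      (∀ᶠ n in atTop, 1 ≤ t n ∧ Real.log (t n) ≤ C₂ * (n : ℝ)) →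
      limsup (fun n : ℕ => CondTest.maximinPower n α
        (CondTest.nullSpace M₀ M₁ M₂ (t n) (s n))
        (CondTest.sparseAlt M₀ M₁ M₂ (t n) (s n)
          (c₄ * Real.sqrt (Real.log (t n) / n)))) atTop ≤ (β : EReal)) := by
  have hm : 0 < M₁ ^ 2 := by positivity
  have hδ : 0 < β - α := sub_pos.2 hαβ
  constructor
  · intro C₁ hC₁
    have hs : 0 < √C₁ := Real.sqrt_pos.2 hC₁
    -- With `√t ≤ √C₁ n`, the bound `a` yields `r² ≤ M₂` and `d` yields `r² / M₁² ≤ 1 / 2`. The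
    -- bound `b` is for the `χ²`-divergence: once `c² / M₁² ≤ 1 / 2`, the quadratic requirement with
    -- `24 * exp 2` follows from a linear one with `12 * exp 2`.
    obtain ⟨c, hc, ha, hb, hd⟩ := CondTest.exists_pos_sq_le
      (a := M₂ / √C₁) (b := M₁ ^ 2 * min (1 / 2) ((β - α) ^ 2 / (12 * Real.exp 2)))
      (d := M₁ ^ 2 / (2 * √C₁)) (by positivity) (by positivity) (by positivity)
    refine ⟨c, hc, fun t s hts => limsup_le_of_le (by isBoundedDefault) ?_⟩
    filter_upwards [hts, eventually_ge_atTop 1] with n ⟨ht, htn⟩ hn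
    have hsq : √(t n : ℝ) ≤ √C₁ * n := by
      rw [← Real.sqrt_sq (Nat.cast_nonneg n), ← Real.sqrt_mul hC₁.le]
      exact Real.sqrt_le_sqrt htn
    rw [← div_le_iff₀' hm] at hb
    have hb1 := hb.trans (min_le_left _ _)
    have hb2 := hb.trans (min_le_right _ _)
    rw [le_div_iff₀ (by positivity)] at ha hd hb2
    have hc0 : 0 ≤ c ^ 2 / M₁ ^ 2 := by positivity
    refine CondTest.maximinPower_denseAlt_le hαβ hM₀ hM₁ hM₂ ht hn hc hb1 ?_ ?_ ?_
    · calc 24 * Real.exp 2 * (c ^ 2 / M₁ ^ 2) ^ 2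
          = 24 * Real.exp 2 * (c ^ 2 / M₁ ^ 2) * (c ^ 2 / M₁ ^ 2) := by ring
        _ ≤ 24 * Real.exp 2 * (c ^ 2 / M₁ ^ 2) * (1 / 2) := by gcongr
        _ = c ^ 2 / M₁ ^ 2 * (12 * Real.exp 2) := by ring
        _ ≤ _ := hb2
    · calc c ^ 2 / M₁ ^ 2 * √(t n : ℝ) ≤ c ^ 2 / M₁ ^ 2 * (√C₁ * n) := by gcongr
        _ = c ^ 2 * (2 * √C₁) / M₁ ^ 2 * (n / 2) := by ring
        _ ≤ 1 * (n / 2) := by gcongr; exact (div_le_one hm).2 hd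
        _ = _ := one_mul _
    · calc c ^ 2 * √(t n : ℝ) ≤ c ^ 2 * (√C₁ * n) := by gcongr
        _ = c ^ 2 * √C₁ * n := by ring
        _ ≤ M₂ * n := by gcongr
  · intro C₂ hC₂
    -- The roles are as in the dense case, with `log t ≤ C₂ n`; the value `1 / 2` in `b` makes the
    -- Bernoulli exponent `2 c² / M₁²` at most `1`.
    obtain ⟨c, hc, ha, hb, hd⟩ := CondTest.exists_pos_sq_le
      (a := M₂ / C₂) (b := M₁ ^ 2 * min (1 / 2) ((β - α) ^ 2 / 2))
      (d := M₁ ^ 2 / (2 * C₂)) (by positivity) (by positivity) (by positivity)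
    refine ⟨c, hc, fun t s hts => limsup_le_of_le (by isBoundedDefault) ?_⟩
    filter_upwards [hts, eventually_ge_atTop 1] with n ⟨ht, htn⟩ hn
    rw [← div_le_iff₀' hm] at hb
    have hb1 := hb.trans (min_le_left _ _)
    have hb2 := hb.trans (min_le_right _ _)
    rw [le_div_iff₀ (by positivity)] at ha hd
    refine CondTest.maximinPower_sparseAlt_le hαβ hM₀ hM₁ hM₂ ht hn hc (by linarith) (by linarith)
      ?_ ?_
    · calc c ^ 2 / M₁ ^ 2 * Real.log (t n) ≤ c ^ 2 / M₁ ^ 2 * (C₂ * n) := by gcongr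
        _ = c ^ 2 * (2 * C₂) / M₁ ^ 2 * (n / 2) := by ring
        _ ≤ 1 * (n / 2) := by gcongr; exact (div_le_one hm).2 hd
        _ = _ := one_mul _
    · calc c ^ 2 * Real.log (t n) ≤ c ^ 2 * (C₂ * n) := by gcongr
        _ = c ^ 2 * C₂ * n := by ring
        _ ≤ M₂ * n := by gcongr
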